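/- Let $T>0$, let $\Phi\in C^2(\mathbb R,\mathbb R)$ be uniformly convex (that is, $\Phi''\ge\phi$ on $\mathbb R$ for some constant $\phi>0$), let $\ell\in C^1([0,T],\mathbb R)$, and set $\mathcal E(t,z)=\Phi(z)-\ell(t)z$. Let $W\in C^2(\mathbb R,\mathbb R)$ be $1$-periodic and non-constant, and put $$\rho_+=\max W'>0,\qquad \rho_-=\min W'<0,\qquad \mathcal R(v)=\begin{cases}\rho_+v & v\ge 0,\\ \rho_-v & v\le 0.\end{cases}$$ Let $\epsilon_Q>0$ and let $Q\colon(0,\epsilon_Q)\times\mathbb R\to\mathbb R$ be $1$-periodic and $C^2$ in the second variable, with $|Q(\epsilon;y)|<C_{Q,0}$ and $|Q'(\epsilon;y)|<C_{Q,1}$ for all $\epsilon\in(0,\epsilon_Q)$ and $y\in\mathbb R$, where the prime denotes $\partial_y$ and $C_{Q,0},C_{Q,1}>0$ are constants. Let $\gamma>0$ and, for $\epsilon\in(0,\epsilon_Q)$, set $$\mathcal E_\epsilon(t,z)=\Phi(z)-\ell(t)z+\epsilon W\!\left(\tfrac z\epsilon\right)+\epsilon^2Q\!\left(\epsilon;\tfrac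 z\epsilon\right),\qquad \mathcal R_\epsilon(v)=\tfrac{\epsilon^\gamma}{2}v^2 .$$ A solution on $[0,T]$ of either problem below is an absolutely continuous function on $[0,T]$ satisfying it for almost every $t\in[0,T]$. For each $\epsilon\in(0,\epsilon_Q)$ let $z_\epsilon\colon[0,T]\to\mathbb R$ be a solution of $$0=D\mathcal R_\epsilon(\dot z_\epsilon(t))+D_z\mathcal E_\epsilon(t,z_\epsilon(t)),$$ and suppose that, as $\epsilon\to0$, $z_\epsilon(0)\to z^0$ for some $z^0$ with $\Phi'(z^0)\in[\ell(0)-\rho_+,\ \ell(0)-\rho_-]$. Then the differential inclusion $$0\in\partial\mathcal R(\dot z(t))+D_z\mathcal E(t,z(t))$$ has a unique solution $\bar z\colon[0,T]\to\mathbb R$ with $\bar z(0)=z^0$. Moreover, as $\epsilon\to0$, $z_\epsilon\to\bar z$ uniformly on $[0,T]$, and $$\int_{t_1}^{t_2}2\mathcal R_\epsilon(\dot z_\epsilon(t))\,dt\ \longrightarrow\ \int_{t_1}^{t_2}\mathcal R(\dot{\bar z}(t))\,dt\qquad\text{for all }0\le t_1<t_2\le T,$$ all these integrals being finite. -/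

import Mathlib

open Set Filter Topology MeasureTheory
open scoped Pointwise

noncomputable section

namespace WigglyFriction

/-- The energy `E(t, y) = Φ(y) - ℓ(t) y`. -/
def energy (Φ ℓ : ℝ → ℝ) (t y : ℝ) : ℝ :=
  Φ y - ℓ t * y

/-- The wiggly perturbation `V_ε(y) = ε W(y/ε) + ε² Q(ε; y/ε)`. -/
def wigglyPotential (W : ℝ → ℝ) (Q : ℝ → ℝ → ℝ) (ε y : ℝ) : ℝ :=
  ε * W (y / ε) + ε ^ 2 * Q ε (y / ε)

/-- The perturbed energy `E_ε(t, y) = Φ(y) - ℓ(t) y + V_ε(y)`. -/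
def wigglyEnergy (Φ ℓ W : ℝ → ℝ) (Q : ℝ → ℝ → ℝ) (ε t y : ℝ) : ℝ :=
  energy Φ ℓ t y + wigglyPotential W Q ε y

/-- The rate-independent dissipation potential: `R(v) = ρ₊ v` for `v ≥ 0`, `ρ₋ v` for `v ≤ 0`. -/
def dryFriction (ρplus ρminus v : ℝ) : ℝ :=
  if 0 ≤ v then ρplus * v else ρminus * v

/-- The viscous (Rayleigh) dissipation potential `R_ε(v) = (ε^γ / 2) v²`. -/
def viscousFriction (γ ε v : ℝ) : ℝ :=
  ε ^ γ / 2 * v ^ 2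

/-- The convex subdifferential of a function on the real line. -/
def subdifferential (R : ℝ → ℝ) (v : ℝ) : Set ℝ :=
  {p | ∀ w, R v + p * (w - v) ≤ R w}

/-- `z` is an (absolutely continuous) solution on `[0,T]` of the differential inclusion
`0 ∈ ∂R(ż) + D_z E(t, z)`, required for almost every `t ∈ [0,T]`. -/
def IsInclusionSolution (T : ℝ) (R : ℝ → ℝ) (E : ℝ → ℝ → ℝ) (z : ℝ → ℝ) : Prop :=
  AbsolutelyContinuousOnInterval z 0 T ∧
    ∀ᵐ t ∂(volume.restrict (Icc 0 T)), ∃ v, HasDerivAt z v t ∧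
      (0 : ℝ) ∈ subdifferential R v + {deriv (fun y => E t y) (z t)}

/-- `z` is an (absolutely continuous) solution on `[0,T]` of the differential equation
`0 = D R(ż) + D_z E(t, z)`, required for almost every `t ∈ [0,T]`. -/
def IsEquationSolution (T : ℝ) (R : ℝ → ℝ) (E : ℝ → ℝ → ℝ) (z : ℝ → ℝ) : Prop :=
  AbsolutelyContinuousOnInterval z 0 T ∧
    ∀ᵐ t ∂(volume.restrict (Icc 0 T)), ∃ v, HasDerivAt z v t ∧
      0 = deriv R v + deriv (fun y => E t y) (z t)

end WigglyFriction

end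

/-!
Write `u = ℓ - Φ'(z)` for the force acting on a position `z`. A solution of the dry friction
inclusion is a *play*: `u` stays in `[ρ₋, ρ₊]`, and `z` can rise only while `u = ρ₊` and fall only
while `u = ρ₋`. The wiggly viscous problem `ε^γ ż = u - V_ε'(z)` obeys the same rules up to a
tolerance that vanishes with `ε` (`upwardPlay_of_overdamped`). If `u` exceeds `ρ₊` noticeably, then
`ż` is of order `ε^(-γ)`, and since `Φ'` is strongly monotone `u` drops at once. If `u` is
noticeably below `ρ₊`, then the points where `V_ε'` is close to its maximum, which occur in every
interval of length `ε`, are barriers that `z` cannot cross upwards, so `z` gains at most `ε`. The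
downward rule is the upward one for `-z`. Notions and lemmas for the upward rule are therefore
stated for an arbitrary pair `(u, z)` and applied to `(-u, -z)` as well.

Two approximate plays stay uniformly close (`ApproxPlay.sub_le`): where `z` exceeds `z'` by some
`δ`, strong monotonicity puts `u` below `u'` by `m * δ`, so that `u` is away from `ρ₊` and `u'` is
away from `ρ₋`, and the gap cannot grow. This one comparison shows that the `z_ε` form a uniform
Cauchy family, and that the solution of the inclusion is unique. The limit is an exact play, which
is Lipschitz (`lipschitzOnWith_of_approxPlay`) and hence solves the inclusion almost everywhere
(`isInclusionSolution_of_approxPlay`); no separate existence theory is needed.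

For the dissipation, both `2 R_ε(ż_ε)` and `R(ż)` equal the power `(ℓ - Ψ'(z)) ż` with `Ψ = Φ + V_ε`
and `Ψ = Φ` respectively. Integration by parts (`integral_sub_deriv_mul_deriv`) removes the
derivative of `z` from the integral of this power, and what is left passes to the uniform limit.
-/

namespace WigglyFriction

/-! ### Approximate play operators -/

/-- The upward half of the play rule, with tolerance `η`, for a position `z` driven by a force `u`
on `[0,T]`: the force exceeds the threshold `ρ` by at most `η`, and as long as it stays `η` below
the threshold the position rises by at most `η`. The downward half is the same condition on `-u`
and `-z`, with the threshold negated. -/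
structure UpwardPlay (T ρ η : ℝ) (u z : ℝ → ℝ) : Prop where
  force_le : ∀ t ∈ Icc 0 T, u t ≤ ρ + η
  le_add : ∀ a b, 0 ≤ a → a ≤ b → b ≤ T → (∀ τ ∈ Icc a b, u τ ≤ ρ - η) → z b ≤ z a + η

/-- The play rule with thresholds `ρm` and `ρp` and tolerance `η`. -/
structure ApproxPlay (T ρm ρp η : ℝ) (u z : ℝ → ℝ) : Prop where
  up : UpwardPlay T ρp η u z
  down : UpwardPlay T (-ρm) η (fun t => -u t) (fun t => -z t)

theorem exists_last_crossing {h : ℝ → ℝ} {a b c : ℝ} (hab : a ≤ b)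
    (hh : ContinuousOn h (Icc a b)) (ha : h a ≤ c) (hb : c < h b) :
    ∃ s ∈ Icc a b, h s = c ∧ ∀ τ ∈ Icc s b, c ≤ h τ := by
  have hcl : IsClosed (Icc a b ∩ h ⁻¹' Iic c) :=
    hh.preimage_isClosed_of_isClosed isClosed_Icc isClosed_Iic
  obtain ⟨s, ⟨hs, hsc⟩, hmax⟩ :=
    (isCompact_Icc.of_isClosed_subset hcl inter_subset_left).exists_isGreatest
      ⟨a, left_mem_Icc.2 hab, ha⟩
  obtain ⟨s', hs', hs'c⟩ := intermediate_value_Icc hs.2 (hh.mono (Icc_subset_Icc_left hs.1))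
    ⟨hsc, hb.le⟩
  have h1 : s' ≤ s := hmax ⟨⟨hs.1.trans hs'.1, hs'.2⟩, hs'c.le⟩
  obtain rfl : s' = s := le_antisymm h1 hs'.1
  refine ⟨s', hs, hs'c, fun τ hτ => ?_⟩
  by_contra! hlt
  have h2 : τ ≤ s' := hmax ⟨⟨hs.1.trans hτ.1, hτ.2⟩, hlt.le⟩
  obtain rfl : τ = s' := le_antisymm h2 hτ.1
  exact hlt.ne hs'c

/-- Two approximate plays whose forces decrease in the position with rate `m` stay close: wherever
`z` exceeds `z'` by `δ / 2`, the force on `z` lies so far below that on `z'` that neither can `z`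
rise nor `z'` fall by more than the tolerance. -/
theorem ApproxPlay.sub_le {T ρm ρp η δ m : ℝ} {u u' z z' : ℝ → ℝ} (hm : 0 < m) (hδ : 0 < δ)
    (hz : ContinuousOn z (Icc 0 T)) (hz' : ContinuousOn z' (Icc 0 T))
    (h : ApproxPlay T ρm ρp η u z) (h' : ApproxPlay T ρm ρp η u' z')
    (hmono : ∀ t ∈ Icc 0 T, z' t ≤ z t → u t ≤ u' t - m * (z t - z' t))
    (hηδ : 4 * η ≤ δ) (hηm : 4 * η ≤ m * δ) (h0 : z 0 - z' 0 ≤ δ / 2) :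
    ∀ t ∈ Icc 0 T, z t - z' t ≤ δ := by
  intro t ht
  by_contra! hlt
  obtain ⟨s, hs, hsc, hge⟩ := exists_last_crossing (h := fun τ => z τ - z' τ) (c := δ / 2) ht.1
    ((hz.sub hz').mono (Icc_subset_Icc_right ht.2)) h0 (by linarith)
  have key : ∀ τ ∈ Icc s t, u τ ≤ u' τ - m * (δ / 2) ∧ τ ∈ Icc 0 T := by
    intro τ hτ
    have hτT : τ ∈ Icc 0 T := ⟨hs.1.trans hτ.1, hτ.2.trans ht.2⟩
    have h1 := hge τ hτ
    have h2 := hmono τ hτT (by linarith)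
    have h3 := mul_le_mul_of_nonneg_left h1 hm.le
    exact ⟨by linarith, hτT⟩
  have hup := h.up.le_add s t hs.1 hs.2 ht.2 fun τ hτ => by
    have h1 := h'.up.force_le τ (key τ hτ).2
    linarith [(key τ hτ).1]
  have hdown := h'.down.le_add s t hs.1 hs.2 ht.2 fun τ hτ => by
    have h1 := h.down.force_le τ (key τ hτ).2
    linarith [(key τ hτ).1]
  linarith

/-- The overdamped motion `κ ż = u - g(z)`, `κ` small, over a wiggly profile `g ≤ ρ + c` which
comes within `c` of `ρ` on every interval of length `η` obeys the upward play rule. A force above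
`ρ + η / 2` makes `z` climb so fast that the force drops, and for a force below `ρ - η` the
peaks of `g` are barriers that `z` cannot pass from below. -/
theorem upwardPlay_of_overdamped {T ρ η κ c m L : ℝ} {u z g : ℝ → ℝ} (hκ : 0 < κ) (hη : 0 < η)
    (hm : 0 < m)
    (hu : ContinuousOn u (Icc 0 T)) (hz : ContinuousOn z (Icc 0 T))
    (hder : ∀ t ∈ Ico 0 T, HasDerivWithinAt z ((u t - g (z t)) / κ) (Ici t) t)
    (hforce : ∀ s t, 0 ≤ s → s ≤ t → t ≤ T → z s ≤ z t → u t - u s ≤ L * (t - s) - m * (z t - z s))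
    (hg : ∀ x, g x ≤ ρ + c) (hpeak : ∀ x, ∃ p ∈ Icc x (x + η), ρ - c ≤ g p)
    (hc : 4 * c ≤ η) (hκL : 4 * κ * L ≤ m * η) (h0 : u 0 ≤ ρ + η / 2) :
    UpwardPlay T ρ η u z := by
  refine ⟨fun t ht => ?_, fun a b ha hab hb hle => ?_⟩
  · by_contra! hlt
    obtain ⟨s, hs, hsc, hge⟩ := exists_last_crossing (h := u) (c := ρ + η / 2) ht.1
      (hu.mono (Icc_subset_Icc_right ht.2)) h0 (by linarith)
    have hclimb : z s + η / (4 * κ) * (t - s) ≤ z t := by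
      refine image_le_of_deriv_right_le_deriv_boundary (a := s) (b := t)
        (f := fun τ => z s + η / (4 * κ) * (τ - s)) (f' := fun _ => η / (4 * κ))
        (B := z) (B' := fun τ => (u τ - g (z τ)) / κ) (by fun_prop) (fun τ _ => ?_) (by simp)
        (hz.mono (Icc_subset_Icc hs.1 ht.2))
        (fun τ hτ => hder τ ⟨hs.1.trans hτ.1, hτ.2.trans_le ht.2⟩) (fun τ hτ => ?_)
        (right_mem_Icc.2 hs.2)
      · simpa using ((((hasDerivAt_id τ).sub_const s).const_mul (η / (4 * κ))).const_add
          (z s)).hasDerivWithinAt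
      · have h1 := hge τ ⟨hτ.1, hτ.2.le⟩
        have h2 := hg (z τ)
        rw [div_le_div_iff₀ (by positivity) hκ]
        nlinarith
    have hst : 0 ≤ t - s := by linarith [hs.2]
    have hpos : 0 ≤ η / (4 * κ) * (t - s) := by positivity
    have h1 := hforce s t hs.1 hs.2 ht.2 (by linarith)
    have h2 : m * (η / (4 * κ) * (t - s)) ≤ m * (z t - z s) :=
      mul_le_mul_of_nonneg_left (by linarith) hm.le
    have h3 : L ≤ m * (η / (4 * κ)) := by
      rw [← mul_div_assoc, le_div_iff₀ (by positivity)]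
      linarith
    have h4 := mul_le_mul_of_nonneg_right h3 hst
    linarith
  · obtain ⟨p, hp, hgp⟩ := hpeak (z a)
    refine le_trans ?_ hp.2
    refine image_le_of_deriv_right_lt_deriv_boundary' (a := a) (b := b) (f := z)
      (f' := fun τ => (u τ - g (z τ)) / κ) (B := fun _ => p) (B' := fun _ => 0)
      (hz.mono (Icc_subset_Icc ha hb))
      (fun τ hτ => hder τ ⟨ha.trans hτ.1, hτ.2.trans_le hb⟩) hp.1 continuousOn_const
      (fun τ _ => hasDerivWithinAt_const _ _ _) (fun τ hτ hzp => ?_) (right_mem_Icc.2 hab)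
    have h1 := hle τ ⟨hτ.1, hτ.2.le⟩
    refine div_neg_of_neg_of_pos ?_ hκ
    rw [hzp]
    linarith

/-- A uniform limit of upward plays whose tolerances tend to zero is one with every positive
tolerance. -/
theorem UpwardPlay.of_tendstoUniformlyOn {ι : Type*} {l : Filter ι} [l.NeBot] {T ρ : ℝ}
    {U Z : ι → ℝ → ℝ} {u z : ℝ → ℝ} (hU : TendstoUniformlyOn U u l (Icc 0 T))
    (hZ : TendstoUniformlyOn Z z l (Icc 0 T))
    (h : ∀ η > 0, ∀ᶠ i in l, UpwardPlay T ρ η (U i) (Z i)) {η : ℝ} (hη : 0 < η) :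
    UpwardPlay T ρ η u z := by
  have hη4 : 0 < η / 4 := by positivity
  obtain ⟨i, hi, hUi, hZi⟩ := ((h _ hη4).and ((Metric.tendstoUniformlyOn_iff.1 hU _ hη4).and
    (Metric.tendstoUniformlyOn_iff.1 hZ _ hη4))).exists
  simp only [Real.dist_eq, abs_lt] at hUi hZi
  refine ⟨fun t ht => ?_, fun a b ha hab hb hle => ?_⟩
  · linarith [hi.force_le t ht, (hUi t ht).2]
  · have h1 := hi.le_add a b ha hab hb fun τ hτ => by
      linarith [hle τ hτ, (hUi τ ⟨ha.trans hτ.1, hτ.2.trans hb⟩).1]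
    linarith [(hZi a ⟨ha, hab.trans hb⟩).1, (hZi b ⟨ha.trans hab, hb⟩).2]

/-! ### Exact play operators -/

section Exact

variable {T ρ : ℝ} {u z : ℝ → ℝ}

theorem force_le_of_upwardPlay (h : ∀ η > 0, UpwardPlay T ρ η u z) {t : ℝ} (ht : t ∈ Icc 0 T) :
    u t ≤ ρ :=
  le_of_forall_pos_le_add fun η hη => (h η hη).force_le t ht

theorem le_of_upwardPlay (h : ∀ η > 0, UpwardPlay T ρ η u z) (hu : ContinuousOn u (Icc 0 T))
    {a b : ℝ} (ha : 0 ≤ a) (hab : a ≤ b) (hb : b ≤ T) (hlt : ∀ τ ∈ Icc a b, u τ < ρ) :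
    z b ≤ z a := by
  obtain ⟨σ, hσ, hmax⟩ := isCompact_Icc.exists_isMaxOn (nonempty_Icc.2 hab)
    (hu.mono (Icc_subset_Icc ha hb))
  refine le_of_forall_pos_le_add fun η hη => ?_
  have hσρ : 0 < ρ - u σ := sub_pos.2 (hlt σ hσ)
  have h1 := (h (min η (ρ - u σ)) (lt_min hη hσρ)).le_add a b ha hab hb fun τ hτ => by
    have h2 : u τ ≤ u σ := hmax hτ
    linarith [min_le_right η (ρ - u σ)]
  linarith [min_le_left η (ρ - u σ)]

/-- An exact play rises with slope at most `L / m` if the force has slope at most `L` in time and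
decreases in the position with rate `m`: a faster rise would push the force below the threshold. -/
theorem sub_le_of_upwardPlay (h : ∀ η > 0, UpwardPlay T ρ η u z) (hu : ContinuousOn u (Icc 0 T))
    (hz : ContinuousOn z (Icc 0 T)) {m L : ℝ} (hm : 0 < m) (hL : 0 ≤ L)
    (hforce : ∀ s t, 0 ≤ s → s ≤ t → t ≤ T → z s ≤ z t → u t - u s ≤ L * (t - s) - m * (z t - z s))
    {s t : ℝ} (hs : 0 ≤ s) (hst : s ≤ t) (ht : t ≤ T) : z t - z s ≤ L / m * (t - s) := by
  by_contra! hlt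
  have hK : 0 ≤ L / m := by positivity
  -- The level lies strictly between the values of `τ ↦ z τ - L / m * τ` at `s` and `t`.
  obtain ⟨r, hr, hrc, hge⟩ := exists_last_crossing (h := fun τ => z τ - L / m * τ)
    (c := ((z s - L / m * s) + (z t - L / m * t)) / 2) hst
    ((hz.mono (Icc_subset_Icc hs ht)).sub (by fun_prop)) (by linarith) (by linarith)
  have h1 : z t ≤ z r := by
    refine le_of_upwardPlay h hu (hs.trans hr.1) hr.2 ht fun τ hτ => ?_
    have hτs : s ≤ τ := hr.1.trans hτ.1
    have h2 : L / m * (τ - s) < z τ - z s := by linarith [hge τ hτ]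
    have h3 : 0 ≤ L / m * (τ - s) := mul_nonneg hK (by linarith)
    have h4 := hforce s τ hs hτs (hτ.2.trans ht) (by linarith)
    have h5 := mul_lt_mul_of_pos_left h2 hm
    have h6 : m * (L / m * (τ - s)) = L * (τ - s) := by field_simp
    linarith [force_le_of_upwardPlay h (t := s) ⟨hs, hst.trans ht⟩]
  have h7 := mul_le_mul_of_nonneg_left hr.2 hK
  linarith

theorem deriv_nonpos_of_upwardPlay (h : ∀ η > 0, UpwardPlay T ρ η u z)
    (hu : ContinuousOn u (Icc 0 T)) {t v : ℝ} (ht : t ∈ Ioo 0 T) (hv : HasDerivAt z v t)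
    (hlt : u t < ρ) : v ≤ 0 := by
  have hnhds : ∀ᶠ τ in 𝓝 t, u τ < ρ ∧ τ ∈ Ioo 0 T :=
    (((hu.continuousAt (Icc_mem_nhds ht.1 ht.2)).eventually_lt_const hlt)).and
      (isOpen_Ioo.mem_nhds ht)
  obtain ⟨δ, hδ, hball⟩ := Metric.eventually_nhds_iff.1 hnhds
  have hslope : Tendsto (slope z t) (𝓝[>] t) (𝓝 v) :=
    (hasDerivAt_iff_tendsto_slope.1 hv).mono_left (nhdsWithin_mono _ fun x hx => ne_of_gt hx)
  refine le_of_tendsto hslope ?_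
  filter_upwards [Ioo_mem_nhdsGT (show t < t + δ by linarith)] with b hb
  have hmem : ∀ τ ∈ Icc t b, u τ < ρ ∧ τ ∈ Ioo 0 T := fun τ hτ => hball (by
    rw [Real.dist_eq, abs_lt]
    constructor <;> linarith [hτ.1, hτ.2, hb.2])
  have h1 := le_of_upwardPlay h hu ht.1.le hb.1.le (hmem b (right_mem_Icc.2 hb.1.le)).2.2.le
    fun τ hτ => (hmem τ hτ).1
  rw [slope_def_field]
  exact div_nonpos_of_nonpos_of_nonneg (by linarith) (by linarith [hb.1])

theorem upwardPlay_of_ae (hT : 0 < T) (hu : ContinuousOn u (Icc 0 T))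
    (hz : AbsolutelyContinuousOnInterval z 0 T)
    (h : ∀ᵐ t ∂(volume.restrict (Icc 0 T)), u t ≤ ρ ∧ (u t < ρ → deriv z t ≤ 0)) {η : ℝ}
    (hη : 0 < η) : UpwardPlay T ρ η u z := by
  refine ⟨fun t ht => ?_, fun a b ha hab hb hle => ?_⟩
  -- A continuous function that is at most `ρ` almost everywhere is so everywhere.
  · have heq : (fun t => max (u t) ρ) =ᵐ[volume.restrict (Icc 0 T)] fun _ => ρ := by
      filter_upwards [h] with t ht using max_eq_right ht.1
    have h1 := Measure.eqOn_Icc_of_ae_eq volume hT.ne heq (hu.sup continuousOn_const)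
      continuousOn_const ht
    linarith [max_eq_right_iff.1 h1]
  · have hsub : uIcc a b ⊆ uIcc 0 T := by
      rw [uIcc_of_le hab, uIcc_of_le hT.le]
      exact Icc_subset_Icc ha hb
    have hint := (hz.mono hsub).integral_deriv_eq_sub
    have hnonneg : 0 ≤ ∫ t in a..b, -deriv z t := by
      refine intervalIntegral.integral_nonneg_of_ae_restrict hab ?_
      filter_upwards [ae_restrict_of_ae_restrict_of_subset (Icc_subset_Icc ha hb) h,
        ae_restrict_mem measurableSet_Icc] with t ht hmem
      simpa using ht.2 (by linarith [hle t hmem])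
    rw [intervalIntegral.integral_neg] at hnonneg
    linarith

end Exact

/-! ### The dry friction potential -/

theorem dryFriction_eq_max {ρp ρm : ℝ} (hp : 0 < ρp) (hm : ρm < 0) (v : ℝ) :
    dryFriction ρp ρm v = max (ρp * v) (ρm * v) := by
  unfold dryFriction
  split_ifs with h
  · exact (max_eq_left (by nlinarith)).symm
  · exact (max_eq_right (by nlinarith)).symm

/-- The complementarity form of the friction law: `p` lies between the thresholds, and `v` is
positive only if `p = ρp` and negative only if `p = ρm`. -/
theorem mem_subdifferential_dryFriction {ρp ρm : ℝ} (hp : 0 < ρp) (hm : ρm < 0) {p v : ℝ} :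
    p ∈ subdifferential (dryFriction ρp ρm) v ↔
      (p ≤ ρp ∧ (p < ρp → v ≤ 0)) ∧ (ρm ≤ p ∧ (ρm < p → 0 ≤ v)) := by
  have hpos : ∀ v : ℝ, 0 ≤ v → dryFriction ρp ρm v = ρp * v := fun v hv => if_pos hv
  have hneg : ∀ v : ℝ, v ≤ 0 → dryFriction ρp ρm v = ρm * v := fun v hv => by
    rw [dryFriction_eq_max hp hm]
    exact max_eq_right (by nlinarith)
  constructor
  · intro h
    -- Testing with `2 * v` and `0` gives `R v = p * v` because `R` is positively homogeneous.
    have hv : dryFriction ρp ρm v = p * v := by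
      have h0 := h 0
      have h2 := h (2 * v)
      have h2v : dryFriction ρp ρm (2 * v) = 2 * dryFriction ρp ρm v := by
        rcases le_total 0 v with hv | hv
        · rw [hpos _ hv, hpos _ (by linarith)]; ring
        · rw [hneg _ hv, hneg _ (by linarith)]; ring
      have h00 : dryFriction ρp ρm 0 = 0 := by simp [hpos 0 le_rfl]
      rw [h00] at h0
      rw [h2v] at h2
      linarith
    have h1 : p ≤ ρp := by
      have := h 1
      rw [hpos 1 zero_le_one, hv] at this
      linarith
    have h2 : ρm ≤ p := by
      have := h (-1)
      rw [hneg (-1) (by norm_num), hv] at this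
      linarith
    refine ⟨⟨h1, fun hlt => ?_⟩, h2, fun hlt => ?_⟩
    · by_contra! hv0
      rw [hpos v hv0.le] at hv
      nlinarith
    · by_contra! hv0
      rw [hneg v hv0.le] at hv
      nlinarith
  · rintro ⟨⟨h1, h2⟩, h3, h4⟩ w
    have hv : dryFriction ρp ρm v = p * v := by
      rcases lt_trichotomy v 0 with hv | rfl | hv
      · have : p = ρm := le_antisymm (not_lt.1 fun hlt => (h4 hlt).not_gt hv) h3
        rw [hneg v hv.le, this]
      · simp [hpos 0 le_rfl]
      · have : p = ρp := le_antisymm h1 (not_lt.1 fun hlt => (h2 hlt).not_gt hv)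
        rw [hpos v hv.le, this]
    have hw : p * w ≤ dryFriction ρp ρm w := by
      rcases le_total 0 w with hw | hw
      · rw [hpos w hw]; nlinarith
      · rw [hneg w hw]; nlinarith
    rw [hv]
    linarith

theorem dryFriction_eq_mul {ρp ρm : ℝ} (hp : 0 < ρp) (hm : ρm < 0) {p v : ℝ}
    (h : p ∈ subdifferential (dryFriction ρp ρm) v) : dryFriction ρp ρm v = p * v := by
  obtain ⟨⟨h1, h2⟩, h3, h4⟩ := (mem_subdifferential_dryFriction hp hm).1 h
  unfold dryFriction
  split_ifs with hv
  · rcases h1.lt_or_eq with hlt | rfl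
    · rw [le_antisymm (h2 hlt) hv]; simp
    · rfl
  · rcases h3.lt_or_eq with hlt | rfl
    · exact absurd (h4 hlt) hv
    · rfl

theorem zero_mem_subdifferential_add_deriv_energy {ρp ρm : ℝ} {Φ ℓ : ℝ → ℝ}
    (hΦ : Differentiable ℝ Φ) {t x v : ℝ} :
    (0 : ℝ) ∈ subdifferential (dryFriction ρp ρm) v + {deriv (fun y => energy Φ ℓ t y) x} ↔
      ℓ t - deriv Φ x ∈ subdifferential (dryFriction ρp ρm) v := by
  have hd : deriv (fun y => energy Φ ℓ t y) x = deriv Φ x - ℓ t := by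
    refine HasDerivAt.deriv ?_
    simpa [energy] using! (hΦ x).hasDerivAt.sub ((hasDerivAt_id x).const_mul (ℓ t))
  rw [hd, Set.add_singleton, Set.mem_image]
  constructor
  · rintro ⟨p, hp, h0⟩
    rwa [show ℓ t - deriv Φ x = p by linarith]
  · exact fun h => ⟨_, h, by ring⟩

/-! ### Absolutely continuous functions -/

theorem _root_.AbsolutelyContinuousOnInterval.comp_contDiff {Ψ z : ℝ → ℝ} {a b : ℝ}
    (hΨ : ContDiff ℝ 1 Ψ)
    (hz : AbsolutelyContinuousOnInterval z a b) :
    AbsolutelyContinuousOnInterval (fun t => Ψ (z t)) a b := by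
  obtain ⟨C, hC⟩ := hz.exists_bound
  obtain ⟨K, hK⟩ := hΨ.contDiffOn.exists_lipschitzOnWith one_ne_zero (convex_Icc (-C) C)
    isCompact_Icc
  rw [absolutelyContinuousOnInterval_iff] at hz ⊢
  intro ε hε
  obtain ⟨δ, hδ, h⟩ := hz (ε / (K + 1)) (by positivity)
  refine ⟨δ, hδ, fun E hE hlt => ?_⟩
  have h1 := h E hE hlt
  rw [lt_div_iff₀ (by positivity)] at h1
  refine lt_of_le_of_lt ?_ h1
  rw [Finset.sum_mul]
  refine Finset.sum_le_sum fun i hi => ?_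
  have hmem := hE.1 i hi
  have h2 := hK.dist_le_mul _ (abs_le.1 (hC _ hmem.1)) _ (abs_le.1 (hC _ hmem.2))
  refine h2.trans ?_
  rw [mul_comm]
  exact mul_le_mul_of_nonneg_left (by linarith) dist_nonneg

/-- The work of the force `ℓ - Ψ'` along an absolutely continuous path, with the derivative of the
path integrated away. -/
theorem integral_sub_deriv_mul_deriv {Ψ ℓ z : ℝ → ℝ} {a b : ℝ} (hΨ : ContDiff ℝ 1 Ψ)
    (hℓ : AbsolutelyContinuousOnInterval ℓ a b) (hz : AbsolutelyContinuousOnInterval z a b) :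
    ∫ t in a..b, (ℓ t - deriv Ψ (z t)) * deriv z t =
      ℓ b * z b - ℓ a * z a - (∫ t in a..b, deriv ℓ t * z t) - (Ψ (z b) - Ψ (z a)) := by
  have hchain : ∫ t in a..b, deriv Ψ (z t) * deriv z t = Ψ (z b) - Ψ (z a) := by
    rw [← (hz.comp_contDiff hΨ).integral_deriv_eq_sub]
    refine intervalIntegral.integral_congr_ae ?_
    filter_upwards [hz.ae_differentiableAt] with t ht hmem
    exact (((hΨ.differentiable one_ne_zero (z t)).hasDerivAt).comp t
      (ht (uIoc_subset_uIcc hmem)).hasDerivAt).deriv.symm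
  rw [← hchain, ← hℓ.integral_mul_deriv_eq_deriv_mul hz, ← intervalIntegral.integral_sub]
  · simp only [sub_mul]
  · exact hz.intervalIntegrable_deriv.continuousOn_mul hℓ.continuousOn
  · exact hz.intervalIntegrable_deriv.continuousOn_mul
      ((hΨ.continuous_deriv le_rfl).comp_continuousOn hz.continuousOn)

/-- An absolutely continuous function whose derivative agrees almost everywhere with a continuous
function is differentiable from the right everywhere. -/
theorem hasDerivWithinAt_of_ae_deriv_eq {z F : ℝ → ℝ} {T : ℝ} (hT : 0 < T)
    (hz : AbsolutelyContinuousOnInterval z 0 T) (hF : ContinuousOn F (Icc 0 T))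
    (h : ∀ᵐ t ∂(volume.restrict (Icc 0 T)), deriv z t = F t) {t : ℝ} (ht : t ∈ Ico 0 T) :
    HasDerivWithinAt z (F t) (Ici t) t := by
  -- Extending `F` continuously to the line makes its primitive differentiable everywhere.
  set G : ℝ → ℝ := IccExtend hT.le ((Icc 0 T).domRestrict F) with hG
  have hGc : Continuous G := hF.domRestrict.Icc_extend'
  have hGF : ∀ s ∈ Icc 0 T, G s = F s := fun s hs => by
    rw [hG, IccExtend_of_mem _ _ hs, domRestrict_apply]
  have hzG : ∀ s ∈ Icc 0 T, z s = z 0 + ∫ τ in 0..s, G τ := by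
    intro s hs
    have hsub : Icc 0 s ⊆ Icc 0 T := Icc_subset_Icc_right hs.2
    rw [show (∫ τ in 0..s, G τ) = ∫ τ in 0..s, deriv z τ from ?_,
      (hz.mono (by rwa [uIcc_of_le hs.1, uIcc_of_le hT.le])).integral_deriv_eq_sub]
    · ring
    · rw [intervalIntegral.integral_of_le hs.1, intervalIntegral.integral_of_le hs.1]
      refine integral_congr_ae ?_
      filter_upwards [ae_restrict_of_ae_restrict_of_subset (Ioc_subset_Icc_self.trans hsub) h,
        ae_restrict_mem measurableSet_Ioc] with τ hτ hmem
      rw [hτ, hGF τ (hsub (Ioc_subset_Icc_self hmem))]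
  have hprim : HasDerivAt (fun s => z 0 + ∫ τ in 0..s, G τ) (F t) t := by
    rw [← hGF t ⟨ht.1, ht.2.le⟩]
    exact (intervalIntegral.integral_hasDerivAt_right (hGc.intervalIntegrable _ _)
      (hGc.stronglyMeasurableAtFilter _ _) hGc.continuousAt).const_add _
  have h1 : HasDerivWithinAt z (F t) (Icc 0 T) t :=
    hprim.hasDerivWithinAt.congr hzG (hzG t ⟨ht.1, ht.2.le⟩)
  refine h1.mono_of_mem_nhdsWithin ?_
  filter_upwards [Icc_mem_nhdsGE ht.2] with s hs using ⟨ht.1.trans hs.1, hs.2⟩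

theorem _root_.StrongConvexOn.mul_sub_le_deriv_sub {Φ : ℝ → ℝ} {m : ℝ}
    (h : StrongConvexOn univ m Φ) (hΦ : Differentiable ℝ Φ) {x y : ℝ} (hxy : x ≤ y) :
    m * (y - x) ≤ deriv Φ y - deriv Φ x := by
  have hd : ∀ x, HasDerivAt (fun x => Φ x - m / 2 * ‖x‖ ^ 2) (deriv Φ x - m * x) x := fun x => by
    have h1 := (hΦ x).hasDerivAt.sub (((hasDerivAt_id x).pow 2).const_mul (m / 2))
    simp only [Real.norm_eq_abs, sq_abs]
    convert! h1 using 1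
    simp
    ring
  have h2 := (strongConvexOn_iff_convex.1 h).monotoneOn_deriv (fun x _ => (hd x).differentiableAt)
    (mem_univ x) (mem_univ y) hxy
  rw [(hd x).deriv, (hd y).deriv] at h2
  linarith

theorem tendsto_integral_mul_of_tendstoUniformlyOn {Z : ℝ → ℝ → ℝ} {z f : ℝ → ℝ} {a b : ℝ}
    {l : Filter ℝ} [l.IsCountablyGenerated] (hf : IntervalIntegrable f volume a b)
    (hZ : TendstoUniformlyOn Z z l (uIcc a b)) (hz : ContinuousOn z (uIcc a b))
    (hZc : ∀ᶠ i in l, ContinuousOn (Z i) (uIcc a b)) :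
    Tendsto (fun i => ∫ t in a..b, f t * Z i t) l (𝓝 (∫ t in a..b, f t * z t)) := by
  obtain ⟨C, hC⟩ := isCompact_uIcc.exists_bound_of_continuousOn hz
  refine intervalIntegral.tendsto_integral_filter_of_dominated_convergence
    (fun t => ‖f t‖ * (C + 1)) ?_ ?_ (hf.norm.mul_const _) ?_
  · filter_upwards [hZc] with i hi
    exact (intervalIntegrable_iff.1 (hf.mul_continuousOn hi)).aestronglyMeasurable
  · filter_upwards [Metric.tendstoUniformlyOn_iff.1 hZ 1 one_pos] with i hi
    refine Eventually.of_forall fun t ht => ?_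
    have hmem := uIoc_subset_uIcc ht
    rw [norm_mul]
    refine mul_le_mul_of_nonneg_left ?_ (norm_nonneg _)
    have h1 := hi t hmem
    rw [dist_comm, dist_eq_norm] at h1
    linarith [norm_le_norm_add_norm_sub' (Z i t) (z t), hC t hmem]
  · exact Eventually.of_forall fun t ht =>
      (hZ.tendsto_at (uIoc_subset_uIcc ht)).const_mul (f t)

theorem _root_.TendstoUniformlyOn.continuous_comp {ι : Type*} {l : Filter ι} {Z : ι → ℝ → ℝ}
    {z f : ℝ → ℝ} {s : Set ℝ} (hs : IsCompact s) (hZ : TendstoUniformlyOn Z z l s)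
    (hz : ContinuousOn z s) (hf : Continuous f) :
    TendstoUniformlyOn (fun i t => f (Z i t)) (fun t => f (z t)) l s := by
  intro r hr
  filter_upwards [hZ _ ((hs.image_of_continuousOn hz).uniformContinuousAt_of_continuousAt f
    (fun _ _ => hf.continuousAt) hr)] with i hi t ht
  exact hi t ht (mem_image_of_mem z ht)

/-! ### Plays with a strongly monotone restoring force -/

section StronglyMonotone

variable {T ρm ρp m L : ℝ} {f ℓ : ℝ → ℝ}

theorem abs_sub_le_of_approxPlay {z z' : ℝ → ℝ} {η δ : ℝ} (hm : 0 < m) (hδ : 0 < δ)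
    (hf : ∀ x y, x ≤ y → m * (y - x) ≤ f y - f x)
    (hz : ContinuousOn z (Icc 0 T)) (hz' : ContinuousOn z' (Icc 0 T))
    (h : ApproxPlay T ρm ρp η (fun t => ℓ t - f (z t)) z)
    (h' : ApproxPlay T ρm ρp η (fun t => ℓ t - f (z' t)) z')
    (hηδ : 4 * η ≤ δ) (hηm : 4 * η ≤ m * δ) (h0 : |z 0 - z' 0| ≤ δ / 2) :
    ∀ t ∈ Icc 0 T, |z t - z' t| ≤ δ := by
  intro t ht
  rw [abs_le] at h0
  have h1 := h.sub_le hm hδ hz hz' h' (fun t _ hle => by linarith [hf _ _ hle]) hηδ hηm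
    h0.2 t ht
  have h2 := h'.sub_le hm hδ hz' hz h (fun t _ hle => by linarith [hf _ _ hle]) hηδ hηm
    (by linarith) t ht
  exact abs_le.2 ⟨by linarith, h1⟩

theorem eqOn_of_approxPlay {z z' : ℝ → ℝ} (hm : 0 < m)
    (hf : ∀ x y, x ≤ y → m * (y - x) ≤ f y - f x)
    (hz : ContinuousOn z (Icc 0 T)) (hz' : ContinuousOn z' (Icc 0 T))
    (h : ∀ η > 0, ApproxPlay T ρm ρp η (fun t => ℓ t - f (z t)) z)
    (h' : ∀ η > 0, ApproxPlay T ρm ρp η (fun t => ℓ t - f (z' t)) z') (h0 : z 0 = z' 0) :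
    EqOn z z' (Icc 0 T) := by
  intro t ht
  refine eq_of_abs_sub_nonpos (le_of_forall_pos_le_add fun δ hδ => ?_)
  have hη : 0 < min (δ / 4) (m * δ / 4) := by positivity
  rw [zero_add]
  exact abs_sub_le_of_approxPlay hm hδ hf hz hz' (h _ hη) (h' _ hη)
    (by linarith [min_le_left (δ / 4) (m * δ / 4)]) (by linarith [min_le_right (δ / 4) (m * δ / 4)])
    (by rw [h0, sub_self, abs_zero]; linarith) t ht

/-- Approximate plays with tolerances tending to zero and convergent initial values converge
uniformly to an exact play; the comparison of approximate plays makes them a Cauchy family. -/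
theorem exists_tendstoUniformlyOn_of_approxPlay {ι : Type*} {l : Filter ι} [l.NeBot]
    {Z : ι → ℝ → ℝ} {z₀ : ℝ} (hT : 0 ≤ T) (hm : 0 < m) (hfc : Continuous f)
    (hf : ∀ x y, x ≤ y → m * (y - x) ≤ f y - f x)
    (hZ : ∀ᶠ i in l, ContinuousOn (Z i) (Icc 0 T))
    (hplay : ∀ η > 0, ∀ᶠ i in l, ApproxPlay T ρm ρp η (fun t => ℓ t - f (Z i t)) (Z i))
    (h0 : Tendsto (fun i => Z i 0) l (𝓝 z₀)) :
    ∃ z : ℝ → ℝ, TendstoUniformlyOn Z z l (Icc 0 T) ∧ ContinuousOn z (Icc 0 T) ∧ z 0 = z₀ ∧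
      ∀ η > 0, ApproxPlay T ρm ρp η (fun t => ℓ t - f (z t)) z := by
  have hcauchy : UniformCauchySeqOn Z l (Icc 0 T) := by
    intro r hr
    obtain ⟨δ, hδ, hδr⟩ := Metric.mem_uniformity_dist.1 hr
    have hδ2 : 0 < δ / 2 := by positivity
    have hη : 0 < min (δ / 2 / 4) (m * (δ / 2) / 4) := by positivity
    have hev := (hplay _ hη).and (hZ.and (Metric.tendsto_nhds.1 h0 (δ / 2 / 4) (by positivity)))
    filter_upwards [hev.prod_mk hev] with i ⟨⟨h1, h1c, h10⟩, h2, h2c, h20⟩ t ht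
    apply hδr
    rw [Real.dist_eq] at h10 h20 ⊢
    refine lt_of_le_of_lt (abs_sub_le_of_approxPlay hm hδ2 hf h1c h2c h1 h2
      (by linarith [min_le_left (δ / 2 / 4) (m * (δ / 2) / 4)])
      (by linarith [min_le_right (δ / 2 / 4) (m * (δ / 2) / 4)]) ?_ t ht) (by linarith)
    rw [abs_lt] at h10 h20
    exact abs_le.2 ⟨by linarith, by linarith⟩
  have hlim : ∀ t, ∃ x, t ∈ Icc 0 T → Tendsto (fun i => Z i t) l (𝓝 x) := fun t => by
    by_cases ht : t ∈ Icc 0 T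
    · obtain ⟨x, hx⟩ := CompleteSpace.complete (hcauchy.cauchy_map ht)
      exact ⟨x, fun _ => hx⟩
    · exact ⟨0, fun h => absurd h ht⟩
  choose z hz using hlim
  have hunif := hcauchy.tendstoUniformlyOn_of_tendsto hz
  have hzc : ContinuousOn z (Icc 0 T) := hunif.continuousOn hZ.frequently
  have hu : TendstoUniformlyOn (fun i t => ℓ t - f (Z i t)) (fun t => ℓ t - f (z t)) l
      (Icc 0 T) := by
    have h1 := hunif.continuous_comp isCompact_Icc hzc hfc
    rw [Metric.tendstoUniformlyOn_iff] at h1 ⊢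
    simpa only [dist_sub_left] using h1
  refine ⟨z, hunif, hzc, tendsto_nhds_unique (hz 0 ⟨le_rfl, hT⟩) h0, fun η hη => ⟨?_, ?_⟩⟩
  · exact UpwardPlay.of_tendstoUniformlyOn hu hunif
      (fun η hη => (hplay η hη).mono fun i hi => hi.up) hη
  · exact UpwardPlay.of_tendstoUniformlyOn (l := l) (U := fun i t => -(ℓ t - f (Z i t)))
      (Z := fun i t => -Z i t) hu.neg hunif.neg
      (fun η hη => (hplay η hη).mono fun i hi => hi.down) hη

theorem lipschitzOnWith_of_approxPlay {z : ℝ → ℝ} (hm : 0 < m) (hL : 0 ≤ L) (hfc : Continuous f)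
    (hf : ∀ x y, x ≤ y → m * (y - x) ≤ f y - f x) (hℓc : ContinuousOn ℓ (Icc 0 T))
    (hℓ : ∀ s ∈ Icc 0 T, ∀ t ∈ Icc 0 T, s ≤ t → |ℓ t - ℓ s| ≤ L * (t - s))
    (hz : ContinuousOn z (Icc 0 T))
    (h : ∀ η > 0, ApproxPlay T ρm ρp η (fun t => ℓ t - f (z t)) z) :
    LipschitzOnWith (L / m).toNNReal z (Icc 0 T) := by
  have hu : ContinuousOn (fun t => ℓ t - f (z t)) (Icc 0 T) := hℓc.sub (hfc.comp_continuousOn hz)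
  have key : ∀ s ∈ Icc 0 T, ∀ t ∈ Icc 0 T, s ≤ t → |z t - z s| ≤ L / m * (t - s) := by
    intro s hs t ht hst
    have h1 := sub_le_of_upwardPlay (fun η hη => (h η hη).up) hu hz hm hL
      (fun s t hs hst ht hle => by
        have h2 := abs_le.1 (hℓ s ⟨hs, hst.trans ht⟩ t ⟨hs.trans hst, ht⟩ hst)
        linarith [hf _ _ hle]) hs.1 hst ht.2
    have h2 := sub_le_of_upwardPlay (fun η hη => (h η hη).down) hu.neg hz.neg hm hL
      (fun s t hs hst ht hle => by
        have h2 := abs_le.1 (hℓ s ⟨hs, hst.trans ht⟩ t ⟨hs.trans hst, ht⟩ hst)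
        linarith [hf _ _ (neg_le_neg_iff.1 hle)]) hs.1 hst ht.2
    exact abs_le.2 ⟨by linarith, h1⟩
  refine LipschitzOnWith.of_dist_le_mul fun s hs t ht => ?_
  rw [Real.coe_toNNReal _ (by positivity), Real.dist_eq, Real.dist_eq]
  rcases le_total s t with hst | hst
  · rw [abs_sub_comm, abs_sub_comm s, abs_of_nonneg (sub_nonneg.2 hst)]
    exact key s hs t ht hst
  · rw [abs_of_nonneg (sub_nonneg.2 hst)]
    exact key t ht s hs hst

/-- Both halves of `upwardPlay_of_overdamped`; the downward half is the upward one for `-z` over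
the reflected profile `x ↦ -g (-x)`. -/
theorem approxPlay_of_overdamped {κ c η ε : ℝ} {z g : ℝ → ℝ} (hκ : 0 < κ) (hη : 0 < η)
    (hm : 0 < m) (hfc : Continuous f)
    (hf : ∀ x y, x ≤ y → m * (y - x) ≤ f y - f x) (hℓc : ContinuousOn ℓ (Icc 0 T))
    (hℓ : ∀ s ∈ Icc 0 T, ∀ t ∈ Icc 0 T, s ≤ t → |ℓ t - ℓ s| ≤ L * (t - s))
    (hz : ContinuousOn z (Icc 0 T))
    (hder : ∀ t ∈ Ico 0 T, HasDerivWithinAt z ((ℓ t - f (z t) - g (z t)) / κ) (Ici t) t)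
    (hgp : ∀ x, g x ≤ ρp + c) (hgm : ∀ x, ρm - c ≤ g x)
    (hpeak : ∀ x, ∃ p ∈ Icc x (x + ε), ρp - c ≤ g p)
    (hpit : ∀ x, ∃ p ∈ Icc x (x + ε), g p ≤ ρm + c)
    (hε : ε ≤ η) (hc : 4 * c ≤ η) (hκL : 4 * κ * L ≤ m * η)
    (h0p : ℓ 0 - f (z 0) ≤ ρp + η / 2) (h0m : ρm - η / 2 ≤ ℓ 0 - f (z 0)) :
    ApproxPlay T ρm ρp η (fun t => ℓ t - f (z t)) z := by
  have hu : ContinuousOn (fun t => ℓ t - f (z t)) (Icc 0 T) := hℓc.sub (hfc.comp_continuousOn hz)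
  constructor
  · refine upwardPlay_of_overdamped hκ hη hm hu hz hder (fun s t hs hst ht hle => ?_) hgp
      (fun x => ?_) hc hκL h0p
    · have h2 := abs_le.1 (hℓ s ⟨hs, hst.trans ht⟩ t ⟨hs.trans hst, ht⟩ hst)
      linarith [hf _ _ hle]
    · obtain ⟨p, hp, h⟩ := hpeak x
      exact ⟨p, ⟨hp.1, hp.2.trans (by linarith)⟩, h⟩
  · refine upwardPlay_of_overdamped (g := fun x => -g (-x)) (c := c) (L := L) hκ hη hm hu.neg
      hz.neg (fun t ht => ?_) (fun s t hs hst ht hle => ?_) (fun x => ?_) (fun x => ?_) hc hκL ?_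
    · refine (hder t ht).neg.congr_deriv ?_
      rw [neg_neg]
      ring
    · have h2 := abs_le.1 (hℓ s ⟨hs, hst.trans ht⟩ t ⟨hs.trans hst, ht⟩ hst)
      linarith [hf _ _ (neg_le_neg_iff.1 hle)]
    · linarith [hgm (-x)]
    · obtain ⟨p, hp, h⟩ := hpit (-x - ε)
      refine ⟨-p, ⟨by linarith [hp.2], by linarith [hp.1]⟩, ?_⟩
      rw [neg_neg]
      linarith
    · linarith

end StronglyMonotone

/-! ### Plays as solutions of the differential inclusion -/

section Inclusion

variable {T ρp ρm : ℝ} {Φ ℓ z : ℝ → ℝ}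

theorem isInclusionSolution_of_approxPlay (hT : 0 < T) (hp : 0 < ρp) (hm : ρm < 0)
    (hΦ : ContDiff ℝ 1 Φ) (hℓ : ContinuousOn ℓ (Icc 0 T))
    (hz : AbsolutelyContinuousOnInterval z 0 T)
    (h : ∀ η > 0, ApproxPlay T ρm ρp η (fun t => ℓ t - deriv Φ (z t)) z) :
    IsInclusionSolution T (dryFriction ρp ρm) (energy Φ ℓ) z := by
  refine ⟨hz, ?_⟩
  have hzc := hz.continuousOn
  rw [uIcc_of_le hT.le] at hzc
  have hu : ContinuousOn (fun t => ℓ t - deriv Φ (z t)) (Icc 0 T) :=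
    hℓ.sub ((hΦ.continuous_deriv le_rfl).comp_continuousOn hzc)
  rw [← Measure.restrict_congr_set Ioo_ae_eq_Icc]
  filter_upwards [ae_restrict_of_ae hz.ae_differentiableAt, ae_restrict_mem measurableSet_Ioo]
    with t hd ht
  have hmem : t ∈ Icc 0 T := Ioo_subset_Icc_self ht
  have hdt := (hd (by rwa [uIcc_of_le hT.le])).hasDerivAt
  refine ⟨_, hdt, ?_⟩
  rw [zero_mem_subdifferential_add_deriv_energy (hΦ.differentiable one_ne_zero),
    mem_subdifferential_dryFriction hp hm]
  refine ⟨⟨force_le_of_upwardPlay (fun η hη => (h η hη).up) hmem,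
    deriv_nonpos_of_upwardPlay (fun η hη => (h η hη).up) hu ht hdt⟩, ?_, fun hlt => ?_⟩
  · linarith [force_le_of_upwardPlay (fun η hη => (h η hη).down) hmem]
  · linarith [deriv_nonpos_of_upwardPlay (fun η hη => (h η hη).down) hu.neg ht hdt.neg
      (neg_lt_neg hlt)]

theorem IsInclusionSolution.ae_mem (hΦ : Differentiable ℝ Φ)
    (h : IsInclusionSolution T (dryFriction ρp ρm) (energy Φ ℓ) z) :
    ∀ᵐ t ∂(volume.restrict (Icc 0 T)),
      ℓ t - deriv Φ (z t) ∈ subdifferential (dryFriction ρp ρm) (deriv z t) := by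
  filter_upwards [h.2] with t ⟨v, hv, hmem⟩
  rw [hv.deriv]
  exact (zero_mem_subdifferential_add_deriv_energy hΦ).1 hmem

theorem IsInclusionSolution.approxPlay (hT : 0 < T) (hp : 0 < ρp) (hm : ρm < 0)
    (hΦ : ContDiff ℝ 1 Φ) (hℓ : ContinuousOn ℓ (Icc 0 T))
    (h : IsInclusionSolution T (dryFriction ρp ρm) (energy Φ ℓ) z) {η : ℝ} (hη : 0 < η) :
    ApproxPlay T ρm ρp η (fun t => ℓ t - deriv Φ (z t)) z := by
  have hzc := h.1.continuousOn
  rw [uIcc_of_le hT.le] at hzc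
  have hu : ContinuousOn (fun t => ℓ t - deriv Φ (z t)) (Icc 0 T) :=
    hℓ.sub ((hΦ.continuous_deriv le_rfl).comp_continuousOn hzc)
  have hae := h.ae_mem (hΦ.differentiable one_ne_zero)
  simp only [mem_subdifferential_dryFriction hp hm] at hae
  constructor
  · exact upwardPlay_of_ae hT hu h.1 (hae.mono fun t ht => ht.1) hη
  · refine upwardPlay_of_ae hT hu.neg h.1.neg (hae.mono fun t ht => ⟨neg_le_neg ht.2.1, ?_⟩) hη
    intro hlt
    rw [deriv.neg]
    exact neg_nonpos.2 (ht.2.2 (neg_lt_neg_iff.1 hlt))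

end Inclusion

/-! ### The wiggly problem -/

section Wiggly

variable {T ε γ : ℝ} {Φ ℓ W z : ℝ → ℝ} {Q : ℝ → ℝ → ℝ}

theorem contDiff_wigglyPotential {n : WithTop ℕ∞} (hW : ContDiff ℝ n W) (hQ : ContDiff ℝ n (Q ε)) :
    ContDiff ℝ n (wigglyPotential W Q ε) := by
  unfold wigglyPotential
  exact (contDiff_const.mul (hW.comp (contDiff_id.div_const _))).add
    (contDiff_const.mul (hQ.comp (contDiff_id.div_const _)))

theorem deriv_wigglyPotential (hε : ε ≠ 0) (hW : Differentiable ℝ W) (hQ : Differentiable ℝ (Q ε))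
    (x : ℝ) : deriv (wigglyPotential W Q ε) x =
      deriv W (x / ε) + ε * deriv (Q ε) (x / ε) := by
  have hid := (hasDerivAt_id x).div_const ε
  have h1 := (((hW (x / ε)).hasDerivAt.comp x hid).const_mul ε).add
    (((hQ (x / ε)).hasDerivAt.comp x hid).const_mul (ε ^ 2))
  refine HasDerivAt.deriv (h1.congr_deriv ?_)
  field_simp

theorem IsEquationSolution.ae_deriv_eq (hε : 0 < ε) (hΦ : Differentiable ℝ Φ)
    (hV : Differentiable ℝ (wigglyPotential W Q ε))
    (h : IsEquationSolution T (viscousFriction γ ε) (wigglyEnergy Φ ℓ W Q ε) z) :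
    ∀ᵐ t ∂(volume.restrict (Icc 0 T)), deriv z t =
      (ℓ t - deriv Φ (z t) - deriv (wigglyPotential W Q ε) (z t)) / ε ^ γ := by
  filter_upwards [h.2] with t ⟨v, hv, heq⟩
  have h1 : deriv (viscousFriction γ ε) v = ε ^ γ * v := by
    refine HasDerivAt.deriv ((((hasDerivAt_id v).pow 2).const_mul (ε ^ γ / 2)).congr_deriv ?_)
    simp
    ring
  have h2 : deriv (fun y => wigglyEnergy Φ ℓ W Q ε t y) (z t) =
      deriv Φ (z t) - ℓ t + deriv (wigglyPotential W Q ε) (z t) := by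
    refine HasDerivAt.deriv ((((hΦ (z t)).hasDerivAt.sub
      ((hasDerivAt_id (z t)).const_mul (ℓ t))).add (hV (z t)).hasDerivAt).congr_deriv ?_)
    simp
  rw [h1, h2] at heq
  rw [hv.deriv, eq_div_iff (Real.rpow_pos_of_pos hε γ).ne']
  linarith

/-- Along a solution the dissipation rate is the power of the forces. -/
theorem IsEquationSolution.ae_dissipation_eq (hε : 0 < ε) (hΦ : Differentiable ℝ Φ)
    (hV : Differentiable ℝ (wigglyPotential W Q ε))
    (h : IsEquationSolution T (viscousFriction γ ε) (wigglyEnergy Φ ℓ W Q ε) z) :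
    ∀ᵐ t ∂(volume.restrict (Icc 0 T)), 2 * viscousFriction γ ε (deriv z t) =
      (ℓ t - deriv (fun y => Φ y + wigglyPotential W Q ε y) (z t)) * deriv z t := by
  filter_upwards [h.ae_deriv_eq hε hΦ hV] with t ht
  rw [eq_div_iff (Real.rpow_pos_of_pos hε γ).ne'] at ht
  rw [deriv_fun_add (hΦ _) (hV _), ← sub_sub, ← ht, viscousFriction]
  ring

/-- Every slope of `W` is attained by the wiggly potential, up to an error `ε * C`, on every
interval of length `ε`. -/
theorem exists_abs_deriv_wigglyPotential_sub_le {C ρ : ℝ} (hε : 0 < ε) (hW : Differentiable ℝ W)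
    (hWper : Function.Periodic W 1) (hQ : Differentiable ℝ (Q ε))
    (hC : ∀ y, |deriv (Q ε) y| ≤ C) (hρ : ρ ∈ range (deriv W)) (x : ℝ) :
    ∃ p ∈ Icc x (x + ε), |deriv (wigglyPotential W Q ε) p - ρ| ≤ ε * C := by
  obtain ⟨y₀, rfl⟩ := hρ
  have hper : Function.Periodic (deriv W) 1 := fun y => by
    rw [← deriv_comp_add_const, funext hWper]
  obtain ⟨y, hy, heq⟩ := hper.exists_mem_Ico one_pos y₀ (x / ε)
  refine ⟨ε * y, ⟨?_, ?_⟩, ?_⟩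
  · have := (div_le_iff₀ hε).1 hy.1
    linarith
  · have := mul_lt_mul_of_pos_left hy.2 hε
    rw [mul_add, mul_div_cancel₀ _ hε.ne', mul_one] at this
    exact this.le
  · rw [deriv_wigglyPotential hε.ne' hW hQ, mul_div_cancel_left₀ _ hε.ne', heq, add_sub_cancel_left,
      abs_mul, abs_of_pos hε]
    exact mul_le_mul_of_nonneg_left (hC y) hε.le

theorem abs_wigglyPotential_le {CW CQ : ℝ} (hε : 0 < ε) (hW : ∀ y, |W y| ≤ CW)
    (hQ : ∀ y, |Q ε y| ≤ CQ) (x : ℝ) :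
    |wigglyPotential W Q ε x| ≤ ε * CW + ε ^ 2 * CQ := by
  unfold wigglyPotential
  refine (abs_add_le _ _).trans (add_le_add ?_ ?_)
  · rw [abs_mul, abs_of_pos hε]
    exact mul_le_mul_of_nonneg_left (hW _) hε.le
  · rw [abs_mul, abs_of_nonneg (sq_nonneg ε)]
    exact mul_le_mul_of_nonneg_left (hQ _) (sq_nonneg ε)

end Wiggly

end WigglyFriction

/-! ### Convergence of the wiggly problem to dry friction -/

theorem theorem1
    (T : ℝ) (hT : 0 < T)
    (Φ : ℝ → ℝ) (hΦ : ContDiff ℝ 2 Φ)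
    (hΦconv : ∃ m : ℝ, 0 < m ∧ StrongConvexOn Set.univ m Φ)
    (ℓ : ℝ → ℝ) (hℓ : ContDiffOn ℝ 1 ℓ (Set.Icc 0 T))
    (W : ℝ → ℝ) (hW : ContDiff ℝ 2 W) (hWper : Function.Periodic W 1)
    (hWnc : ¬ ∃ c : ℝ, ∀ y, W y = c)
    (εQ : ℝ) (hεQ : 0 < εQ)
    (Q : ℝ → ℝ → ℝ)
    (hQ : ∀ ε ∈ Set.Ioo 0 εQ, ContDiff ℝ 2 (Q ε))
    (hQper : ∀ ε ∈ Set.Ioo 0 εQ, Function.Periodic (Q ε) 1)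
    (hQ0 : ∃ C : ℝ, 0 < C ∧ ∀ ε ∈ Set.Ioo 0 εQ, ∀ y, |Q ε y| < C)
    (hQ1 : ∃ C : ℝ, 0 < C ∧ ∀ ε ∈ Set.Ioo 0 εQ, ∀ y, |deriv (Q ε) y| < C)
    (γ : ℝ) (hγ : 0 < γ)
    (ρplus ρminus : ℝ)
    (hρplus : IsGreatest (Set.range (deriv W)) ρplus) (hρplus_pos : 0 < ρplus)
    (hρminus : IsLeast (Set.range (deriv W)) ρminus) (hρminus_neg : ρminus < 0)
    (z : ℝ → ℝ → ℝ)
    (hz : ∀ ε ∈ Set.Ioo 0 εQ,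
      WigglyFriction.IsEquationSolution T (WigglyFriction.viscousFriction γ ε)
        (WigglyFriction.wigglyEnergy Φ ℓ W Q ε) (z ε))
    (z₀ : ℝ)
    (hz₀ : z₀ ∈ deriv Φ ⁻¹' Set.Icc (ℓ 0 - ρplus) (ℓ 0 - ρminus))
    (hinit : Tendsto (fun ε => z ε 0) (𝓝[>] 0) (𝓝 z₀)) :
    ∃ zbar : ℝ → ℝ,
      (WigglyFriction.IsInclusionSolution T (WigglyFriction.dryFriction ρplus ρminus)
          (WigglyFriction.energy Φ ℓ) zbar ∧ zbar 0 = z₀) ∧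
      (∀ w : ℝ → ℝ,
        WigglyFriction.IsInclusionSolution T (WigglyFriction.dryFriction ρplus ρminus)
          (WigglyFriction.energy Φ ℓ) w → w 0 = z₀ → Set.EqOn w zbar (Set.Icc 0 T)) ∧
      TendstoUniformlyOn z zbar (𝓝[>] 0) (Set.Icc 0 T) ∧
      (∀ ε ∈ Set.Ioo 0 εQ, IntervalIntegrable
        (fun t => 2 * WigglyFriction.viscousFriction γ ε (deriv (z ε) t)) volume 0 T) ∧
      IntervalIntegrable
        (fun t => WigglyFriction.dryFriction ρplus ρminus (deriv zbar t)) volume 0 T ∧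
      ∀ t₁ t₂ : ℝ, 0 ≤ t₁ → t₁ < t₂ → t₂ ≤ T →
        Tendsto
          (fun ε => ∫ t in t₁..t₂, 2 * WigglyFriction.viscousFriction γ ε (deriv (z ε) t))
          (𝓝[>] 0)
          (𝓝 (∫ t in t₁..t₂, WigglyFriction.dryFriction ρplus ρminus (deriv zbar t))) := by
  obtain ⟨m, hm, hconv⟩ := hΦconv
  obtain ⟨CQ, -, hCQ⟩ := hQ0
  obtain ⟨C, hC, hCQ1⟩ := hQ1
  have hΦ1 : ContDiff ℝ 1 Φ := hΦ.of_le one_le_two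
  have hΦd : Differentiable ℝ Φ := hΦ1.differentiable one_ne_zero
  have hfc : Continuous (deriv Φ) := hΦ1.continuous_deriv le_rfl
  have hf : ∀ x y, x ≤ y → m * (y - x) ≤ deriv Φ y - deriv Φ x := fun x y hxy =>
    hconv.mul_sub_le_deriv_sub hΦd hxy
  have hWd : Differentiable ℝ W := hW.differentiable two_ne_zero
  have hQd : ∀ ε ∈ Ioo 0 εQ, Differentiable ℝ (Q ε) := fun ε hε =>
    (hQ ε hε).differentiable two_ne_zero
  have hV1 : ∀ ε ∈ Ioo 0 εQ, ContDiff ℝ 1 (WigglyFriction.wigglyPotential W Q ε) := fun ε hε =>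
    WigglyFriction.contDiff_wigglyPotential (hW.of_le one_le_two) ((hQ ε hε).of_le one_le_two)
  have hVd : ∀ ε ∈ Ioo 0 εQ, Differentiable ℝ (WigglyFriction.wigglyPotential W Q ε) :=
    fun ε hε => (hV1 ε hε).differentiable one_ne_zero
  have hℓc : ContinuousOn ℓ (Icc 0 T) := hℓ.continuousOn
  have hℓac : AbsolutelyContinuousOnInterval ℓ 0 T :=
    ContDiffOn.absolutelyContinuousOnInterval (by rwa [uIcc_of_le hT.le])
  obtain ⟨L, hL⟩ := hℓ.exists_lipschitzOnWith one_ne_zero (convex_Icc 0 T) isCompact_Icc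
  have hLip : ∀ s ∈ Icc 0 T, ∀ t ∈ Icc 0 T, s ≤ t → |ℓ t - ℓ s| ≤ L * (t - s) := by
    intro s hs t ht hst
    have h1 := hL.dist_le_mul t ht s hs
    rwa [Real.dist_eq, Real.dist_eq, abs_of_nonneg (sub_nonneg.2 hst)] at h1
  have hεev : ∀ᶠ ε in 𝓝[>] (0 : ℝ), ε ∈ Ioo 0 εQ := Ioo_mem_nhdsGT hεQ
  have hid : Tendsto (fun ε : ℝ => ε) (𝓝[>] 0) (𝓝 0) :=
    tendsto_nhdsWithin_of_tendsto_nhds tendsto_id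
  have hzc : ∀ ε ∈ Ioo 0 εQ, ContinuousOn (z ε) (Icc 0 T) := fun ε hε => by
    simpa only [uIcc_of_le hT.le] using (hz ε hε).1.continuousOn
  -- The condition on `z₀` enters here: initially the force is within the thresholds, in the limit.
  have hplay : ∀ η > 0, ∀ᶠ ε in 𝓝[>] (0 : ℝ), WigglyFriction.ApproxPlay T ρminus ρplus η
      (fun t => ℓ t - deriv Φ (z ε t)) (z ε) := by
    intro η hη
    have hu0 : Tendsto (fun ε => ℓ 0 - deriv Φ (z ε 0)) (𝓝[>] 0) (𝓝 (ℓ 0 - deriv Φ z₀)) :=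
      ((hfc.tendsto z₀).comp hinit).const_sub _
    have hpow : Tendsto (fun ε : ℝ => 4 * ε ^ γ * L) (𝓝[>] 0) (𝓝 0) := by
      have h1 := ((hid.rpow_const (Or.inr hγ.le)).const_mul 4).mul_const (L : ℝ)
      simpa [Real.zero_rpow hγ.ne'] using h1
    have hCε : Tendsto (fun ε : ℝ => 4 * (ε * C)) (𝓝[>] 0) (𝓝 0) := by
      simpa using (hid.mul_const C).const_mul 4
    obtain ⟨hz₀1, hz₀2⟩ := hz₀
    filter_upwards [hεev, hid.eventually_le_const hη, hCε.eventually_le_const hη,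
      hpow.eventually_le_const (mul_pos hm hη),
      hu0.eventually_le_const (show ℓ 0 - deriv Φ z₀ < ρplus + η / 2 by linarith),
      hu0.eventually_const_le (show ρminus - η / 2 < ℓ 0 - deriv Φ z₀ by linarith)]
      with ε hε hεη hCη hpowη h0p h0m
    have hQ1 : ∀ y, |deriv (Q ε) y| ≤ C := fun y => (hCQ1 ε hε y).le
    have hclose : ∀ x, |deriv (WigglyFriction.wigglyPotential W Q ε) x - deriv W (x / ε)| ≤
        ε * C := fun x => by
      rw [WigglyFriction.deriv_wigglyPotential hε.1.ne' hWd (hQd ε hε), add_sub_cancel_left,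
        abs_mul, abs_of_pos hε.1]
      exact mul_le_mul_of_nonneg_left (hQ1 _) hε.1.le
    refine WigglyFriction.approxPlay_of_overdamped (κ := ε ^ γ) (L := L) (ε := ε)
      (g := deriv (WigglyFriction.wigglyPotential W Q ε)) (c := ε * C)
      (Real.rpow_pos_of_pos hε.1 γ) hη hm hfc hf hℓc hLip (hzc ε hε) (fun t ht => ?_)
      (fun x => ?_) (fun x => ?_) (fun x => ?_) (fun x => ?_) hεη hCη hpowη h0p h0m
    · refine WigglyFriction.hasDerivWithinAt_of_ae_deriv_eq hT (hz ε hε).1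
        (F := fun t => (ℓ t - deriv Φ (z ε t) -
          deriv (WigglyFriction.wigglyPotential W Q ε) (z ε t)) / ε ^ γ) ?_
        ((hz ε hε).ae_deriv_eq hε.1 hΦd (hVd ε hε)) ht
      exact ((hℓc.sub (hfc.comp_continuousOn (hzc ε hε))).sub
        (((hV1 ε hε).continuous_deriv le_rfl).comp_continuousOn (hzc ε hε))).div_const _
    · linarith [(abs_le.1 (hclose x)).2, hρplus.2 (mem_range_self (x / ε))]
    · linarith [(abs_le.1 (hclose x)).1, hρminus.2 (mem_range_self (x / ε))]
    · obtain ⟨p, hp, h⟩ := WigglyFriction.exists_abs_deriv_wigglyPotential_sub_le hε.1 hWd hWper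
        (hQd ε hε) hQ1 hρplus.1 x
      exact ⟨p, hp, by linarith [(abs_le.1 h).1]⟩
    · obtain ⟨p, hp, h⟩ := WigglyFriction.exists_abs_deriv_wigglyPotential_sub_le hε.1 hWd hWper
        (hQd ε hε) hQ1 hρminus.1 x
      exact ⟨p, hp, by linarith [(abs_le.1 h).2]⟩
  obtain ⟨zbar, hunif, hbarc, hbar0, hbar⟩ :=
    WigglyFriction.exists_tendstoUniformlyOn_of_approxPlay hT.le hm hfc hf
      (hεev.mono hzc) hplay hinit
  have hbarac : AbsolutelyContinuousOnInterval zbar 0 T := by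
    refine LipschitzOnWith.absolutelyContinuousOnInterval (K := (L / m : ℝ).toNNReal) ?_
    rw [uIcc_of_le hT.le]
    exact WigglyFriction.lipschitzOnWith_of_approxPlay hm L.2 hfc hf hℓc hLip hbarc hbar
  have hsol := WigglyFriction.isInclusionSolution_of_approxPlay hT hρplus_pos hρminus_neg hΦ1 hℓc
    hbarac hbar
  have hdiss : ∀ᵐ t ∂(volume.restrict (Icc 0 T)),
      WigglyFriction.dryFriction ρplus ρminus (deriv zbar t) =
        (ℓ t - deriv Φ (zbar t)) * deriv zbar t :=
    (hsol.ae_mem hΦd).mono fun t ht =>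
      WigglyFriction.dryFriction_eq_mul hρplus_pos hρminus_neg ht
  have hΨ1 : ∀ ε ∈ Ioo 0 εQ,
      ContDiff ℝ 1 (fun y => Φ y + WigglyFriction.wigglyPotential W Q ε y) :=
    fun ε hε => hΦ1.add (hV1 ε hε)
  have hpower : ∀ {Ψ w : ℝ → ℝ}, ContDiff ℝ 1 Ψ → AbsolutelyContinuousOnInterval w 0 T →
      IntervalIntegrable (fun t => (ℓ t - deriv Ψ (w t)) * deriv w t) volume 0 T :=
    fun hΨ hw => hw.intervalIntegrable_deriv.continuousOn_mul
      (hℓac.continuousOn.sub ((hΨ.continuous_deriv le_rfl).comp_continuousOn hw.continuousOn))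
  have hsub : ∀ {a b : ℝ}, 0 ≤ a → a ≤ b → b ≤ T → uIoc a b ⊆ Icc 0 T := fun ha hab hb => by
    rw [uIoc_of_le hab]
    exact Ioc_subset_Icc_self.trans (Icc_subset_Icc ha hb)
  refine ⟨zbar, ⟨hsol, hbar0⟩, fun w hw hw0 => ?_, hunif, fun ε hε => ?_, ?_,
    fun t₁ t₂ ht₁ ht₁₂ ht₂ => ?_⟩
  · have hwc : ContinuousOn w (Icc 0 T) := by
      simpa only [uIcc_of_le hT.le] using hw.1.continuousOn
    exact WigglyFriction.eqOn_of_approxPlay hm hf hwc hbarc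
      (fun η hη => hw.approxPlay hT hρplus_pos hρminus_neg hΦ1 hℓc hη) hbar (hw0.trans hbar0.symm)
  · refine (hpower (hΨ1 ε hε) (hz ε hε).1).congr_ae ?_
    filter_upwards [ae_restrict_of_ae_restrict_of_subset (hsub le_rfl hT.le le_rfl)
      ((hz ε hε).ae_dissipation_eq hε.1 hΦd (hVd ε hε))] with t ht using ht.symm
  · refine (hpower hΦ1 hbarac).congr_ae ?_
    filter_upwards [ae_restrict_of_ae_restrict_of_subset (hsub le_rfl hT.le le_rfl) hdiss]
      with t ht using ht.symm
  · have hIcc : uIcc t₁ t₂ ⊆ Icc 0 T := by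
      rw [uIcc_of_le ht₁₂.le]
      exact Icc_subset_Icc ht₁ ht₂
    have huIcc : uIcc t₁ t₂ ⊆ uIcc 0 T := by rwa [uIcc_of_le hT.le]
    have hIoc := hsub ht₁ ht₁₂.le ht₂
    have hmem₁ : t₁ ∈ Icc 0 T := ⟨ht₁, ht₁₂.le.trans ht₂⟩
    have hmem₂ : t₂ ∈ Icc 0 T := ⟨ht₁.trans ht₁₂.le, ht₂⟩
    have hℓac' := hℓac.mono huIcc
    -- Both dissipation integrals in a form free of derivatives of the positions; the zeros on the
    -- right are the limits of the wiggly potential.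
    have hleft : ∀ ε ∈ Ioo 0 εQ,
        ∫ t in t₁..t₂, 2 * WigglyFriction.viscousFriction γ ε (deriv (z ε) t) =
          ℓ t₂ * z ε t₂ - ℓ t₁ * z ε t₁ - (∫ t in t₁..t₂, deriv ℓ t * z ε t) -
            (Φ (z ε t₂) + WigglyFriction.wigglyPotential W Q ε (z ε t₂) -
              (Φ (z ε t₁) + WigglyFriction.wigglyPotential W Q ε (z ε t₁))) := by
      intro ε hε
      rw [← WigglyFriction.integral_sub_deriv_mul_deriv (hΨ1 ε hε) hℓac' ((hz ε hε).1.mono huIcc)]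
      refine intervalIntegral.integral_congr_ae_restrict ?_
      exact ae_restrict_of_ae_restrict_of_subset hIoc
        ((hz ε hε).ae_dissipation_eq hε.1 hΦd (hVd ε hε))
    have hright : ∫ t in t₁..t₂, WigglyFriction.dryFriction ρplus ρminus (deriv zbar t) =
        ℓ t₂ * zbar t₂ - ℓ t₁ * zbar t₁ - (∫ t in t₁..t₂, deriv ℓ t * zbar t) -
          (Φ (zbar t₂) + 0 - (Φ (zbar t₁) + 0)) := by
      rw [add_zero, add_zero,
        ← WigglyFriction.integral_sub_deriv_mul_deriv hΦ1 hℓac' (hbarac.mono huIcc)]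
      exact intervalIntegral.integral_congr_ae_restrict
        (ae_restrict_of_ae_restrict_of_subset hIoc hdiss)
    obtain ⟨CW, hCW⟩ : ∃ CW, ∀ y, |W y| ≤ CW := by
      obtain ⟨CW, hCW⟩ := (hWper.isBounded_of_continuous one_ne_zero
        hW.continuous).exists_norm_le
      exact ⟨CW, fun y => hCW _ (mem_range_self y)⟩
    have hVlim : ∀ t, Tendsto (fun ε => WigglyFriction.wigglyPotential W Q ε (z ε t)) (𝓝[>] 0)
        (𝓝 0) := fun t => by
      refine squeeze_zero_norm' (a := fun ε => ε * CW + ε ^ 2 * CQ) ?_ ?_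
      · filter_upwards [hεev] with ε hε
        exact WigglyFriction.abs_wigglyPotential_le hε.1 hCW (fun y => (hCQ ε hε y).le) _
      · simpa using (hid.mul_const CW).add ((hid.pow 2).mul_const CQ)
    have hlim₁ := hunif.tendsto_at hmem₁
    have hlim₂ := hunif.tendsto_at hmem₂
    have hint := WigglyFriction.tendsto_integral_mul_of_tendstoUniformlyOn
      hℓac'.intervalIntegrable_deriv (hunif.mono hIcc) (hbarc.mono hIcc)
      (hεev.mono fun ε hε => (hzc ε hε).mono hIcc)
    rw [hright]
    refine Tendsto.congr' (hεev.mono fun ε hε => (hleft ε hε).symm) ?_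
    exact (((hlim₂.const_mul _).sub (hlim₁.const_mul _)).sub hint).sub
      ((((hΦ.continuous.tendsto _).comp hlim₂).add (hVlim t₂)).sub
        (((hΦ.continuous.tendsto _).comp hlim₁).add (hVlim t₁)))
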